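/- A multi-valued map $F: X \Rightarrow Y$ between metric spaces $(X,p)$ and $(Y,d)$ assigns to every $x \in X$ a non-empty set $F(x) \subseteq Y$. It is called continuous at $x \in X$ if there is some $y \in F(x)$ such that for every $\varepsilon > 0$ there is $\delta > 0$ such that for every $x' \in X$ with $p(x,x') < \delta$ there is $y' \in F(x')$ with $d(y,y') < \varepsilon$. This notion cannot in general be reduced to ordinary continuity of $F$ viewed as a single-valued function into the power set of $Y$. Precisely: there is a multi-valued map $F : [0,1] \Rightarrow \mathbb{R}$ (both with the usual metric), with $F(x)$ closed and non-empty for all $x$, such that the set of points at which $F$ is continuous in the above sense is not a $G_\delta$ subset of $[0,1]$, and such that there is no metric $d_F$ on the set $F[X] = \{F(x) : x \in X\}$, where $X = [0,1]$, with the property that for all $x \in X$ the function $F : X \to (F[X], d_F)$ is continuous at $x$ in the usual sense if and only if the multi-valued map $F$ is continuous at $x$ in the above sense. -/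

import Mathlib

/-- Continuity at a point `x` of a multi-valued map `F : X ⇒ Y` between metric spaces: one and the
same value `y ∈ F x` is approximated, at every precision, by values of `F` at all points close
enough to `x`. -/
def MultiContinuousAt {X Y : Type*} [MetricSpace X] [MetricSpace Y] (F : X → Set Y) (x : X) :
    Prop :=
  ∃ y ∈ F x, ∀ ε : ℝ, 0 < ε → ∃ δ : ℝ, 0 < δ ∧
    ∀ x' ∈ Metric.ball x δ, ∃ y' ∈ F x', dist y y' < ε

open Set Metric

/-! For a dense sequence `q`, branch `n` of `branches q` passes through the value `n` at `q n` and
tends to it there, whatever the sign. Off `range q` all values sit strictly above integers, while at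
the dense points `q k` they sit at or below, so no value is approximated. The continuity set is thus
`range q`, countable and dense, hence not Gδ by Baire; but a single-valued map into a metric space
has a Gδ set of continuity points. -/

/-- The multi-valued map attached to a sequence `q`: its value at `x` has exactly one point
`n ± dist x (q n) / 4` near each natural number `n`, with the sign depending on whether `x` is a
term of `q`. -/
def branches {X : Type*} [MetricSpace X] (q : ℕ → X) (x : X) : Set ℝ :=
  open Classical in
  range fun n : ℕ => (n : ℝ) + (if x ∈ range q then -1 else 1) * (dist x (q n) / 4)

theorem exists_mem_branches {X : Type*} [MetricSpace X] (q : ℕ → X) (x : X) (n : ℕ) :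
    ∃ y ∈ branches q x, |y - n| = dist x (q n) / 4 := by
  refine ⟨_, ⟨n, rfl⟩, ?_⟩
  have h : 0 ≤ dist x (q n) / 4 := by positivity
  split_ifs
  · simp only [add_sub_cancel_left, neg_one_mul, abs_neg, abs_of_nonneg h]
  · simp only [add_sub_cancel_left, one_mul, abs_of_nonneg h]

theorem mem_branches_of_mem {X : Type*} [MetricSpace X] {q : ℕ → X} {x : X} (hx : x ∈ range q)
    {y : ℝ} : y ∈ branches q x ↔ ∃ n : ℕ, (n : ℝ) - dist x (q n) / 4 = y := by
  simp only [branches, if_pos hx, neg_one_mul, ← sub_eq_add_neg, mem_range]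

theorem mem_branches_of_notMem {X : Type*} [MetricSpace X] {q : ℕ → X} {x : X} (hx : x ∉ range q)
    {y : ℝ} : y ∈ branches q x ↔ ∃ n : ℕ, (n : ℝ) + dist x (q n) / 4 = y := by
  simp only [branches, if_neg hx, one_mul, mem_range]

theorem branches_nonempty {X : Type*} [MetricSpace X] (q : ℕ → X) (x : X) :
    (branches q x).Nonempty := range_nonempty _

theorem isClosed_branches {X : Type*} [MetricSpace X] (q : ℕ → X)
    (hd : ∀ x y : X, dist x y ≤ 1) (x : X) : IsClosed (branches q x) := by
  -- At a fixed `x` all offsets have the same sign and size at most `1/4`, so distinct branches are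
  -- at least `3/4` apart.
  refine isClosed_of_pairwise_le_dist (ε := 1 / 2) (by norm_num) ?_
  have key : ∀ (s : ℝ), s = -1 ∨ s = 1 → ∀ m n : ℕ, m < n →
      1 / 2 ≤ |((m : ℝ) + s * (dist x (q m) / 4)) - (n + s * (dist x (q n) / 4))| := by
    intro s hs m n hmn
    have hmn' : (m : ℝ) + 1 ≤ n := by exact_mod_cast hmn
    have h₁ := hd x (q m)
    have h₂ := hd x (q n)
    have h₃ := dist_nonneg (x := x) (y := q m)
    have h₄ := dist_nonneg (x := x) (y := q n)
    rw [abs_sub_comm]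
    refine le_trans ?_ (le_abs_self _)
    rcases hs with rfl | rfl <;> linarith
  rintro _ ⟨m, rfl⟩ _ ⟨n, rfl⟩ hne
  have hs : ∀ p : Prop, ∀ _ : Decidable p,
      (if p then (-1 : ℝ) else 1) = -1 ∨ (if p then (-1 : ℝ) else 1) = 1 := by
    intro p _
    split_ifs <;> simp
  rw [Real.dist_eq]
  rcases lt_trichotomy m n with h | rfl | h
  · exact key _ (hs _ _) m n h
  · exact absurd rfl hne
  · rw [abs_sub_comm]
    exact key _ (hs _ _) n m h

theorem multiContinuousAt_branches {X : Type*} [MetricSpace X] (q : ℕ → X) (n : ℕ) :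
    MultiContinuousAt (branches q) (q n) := by
  obtain ⟨y, hy, hyn⟩ := exists_mem_branches q (q n) n
  obtain rfl : y = n := by simpa [sub_eq_zero] using hyn
  refine ⟨n, hy, fun ε hε => ⟨ε, hε, fun x hx => ?_⟩⟩
  obtain ⟨z, hz, hzn⟩ := exists_mem_branches q x n
  refine ⟨z, hz, ?_⟩
  rw [dist_comm, Real.dist_eq, hzn]
  have := mem_ball.1 hx
  linarith

theorem not_multiContinuousAt_branches {X : Type*} [MetricSpace X] {q : ℕ → X}
    (hq : DenseRange q) (hd : ∀ x y : X, dist x y ≤ 1) {x : X} (hx : x ∉ range q) :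
    ¬ MultiContinuousAt (branches q) x := by
  rintro ⟨y, hy, hc⟩
  obtain ⟨n, rfl⟩ := (mem_branches_of_notMem hx).1 hy
  have hpos : 0 < dist x (q n) := dist_pos.2 fun h => hx ⟨n, h.symm⟩
  obtain ⟨δ, hδ, hc⟩ := hc _ (show 0 < dist x (q n) / 4 by positivity)
  obtain ⟨k, hk⟩ := hq.exists_dist_lt x hδ
  obtain ⟨z, hz, hyz⟩ := hc (q k) (by rwa [mem_ball, dist_comm])
  obtain ⟨m, rfl⟩ := (mem_branches_of_mem (mem_range_self k)).1 hz
  have h₁ := hd x (q n)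
  have h₂ := hd (q k) (q m)
  have h₃ := dist_nonneg (x := q k) (y := q m)
  rw [Real.dist_eq, abs_lt] at hyz
  -- A value with `m > n` is at least `n + 3/4`, too far above `y ≤ n + 1/4`; one with `m ≤ n` is at
  -- most `n`, so it misses `y` by the full `ε`.
  rcases lt_or_ge n m with h | h
  · have h' : (n : ℝ) + 1 ≤ m := by exact_mod_cast h
    linarith
  · have h' : (m : ℝ) ≤ n := by exact_mod_cast h
    linarith

theorem setOf_multiContinuousAt_branches {X : Type*} [MetricSpace X] {q : ℕ → X}
    (hq : DenseRange q) (hd : ∀ x y : X, dist x y ≤ 1) :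
    {x | MultiContinuousAt (branches q) x} = range q := by
  ext x
  refine ⟨fun h => ?_, ?_⟩
  · by_contra hx
    exact not_multiContinuousAt_branches hq hd hx h
  · rintro ⟨n, rfl⟩
    exact multiContinuousAt_branches q n

/-- Without isolated points, the complement of a countable set is a dense Gδ; by Baire it would meet
`s` if `s` were Gδ. -/
theorem not_isGδ_of_countable_of_dense {X : Type*} [TopologicalSpace X] [BaireSpace X] [T1Space X]
    [Nonempty X] [∀ x : X, (nhdsWithin x {x}ᶜ).NeBot] {s : Set X} (hc : s.Countable)
    (hs : Dense s) : ¬ IsGδ s := by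
  intro hG
  have hd : Dense sᶜ := by
    rw [← biUnion_of_singleton s, compl_iUnion₂]
    exact dense_biInter_of_isOpen (fun x _ => isOpen_compl_singleton) hc
      fun x _ => dense_compl_singleton x
  have h := hs.inter_of_Gδ hG hc.isGδ_compl hd
  simpa using h.nonempty

theorem corollary2p7 :
    ∃ F : Set.Icc (0 : ℝ) 1 → Set ℝ,
      (∀ x, (F x).Nonempty) ∧
      (∀ x, IsClosed (F x)) ∧
      ¬ IsGδ {x | MultiContinuousAt F x} ∧
      ∀ _ : MetricSpace (Set.range F),
        ¬ ∀ x, ContinuousAt (Set.rangeFactorization F) x ↔ MultiContinuousAt F x := by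
  have hd : ∀ x y : Icc (0 : ℝ) 1, dist x y ≤ 1 := fun x y => by
    simpa [Subtype.dist_eq] using Real.dist_le_of_mem_Icc x.2 y.2
  have hq := TopologicalSpace.denseRange_denseSeq (Icc (0 : ℝ) 1)
  have hG : ¬ IsGδ {x | MultiContinuousAt
      (branches (TopologicalSpace.denseSeq (Icc (0 : ℝ) 1))) x} := by
    rw [setOf_multiContinuousAt_branches hq hd]
    exact not_isGδ_of_countable_of_dense (countable_range _) hq
  refine ⟨_, branches_nonempty _, isClosed_branches _ hd, hG, fun _ h => hG ?_⟩
  simp only [← h]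
  exact IsGδ.setOfPred_continuousAt _
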